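/- \textbf{Setting.} For a real order-$d$ tensor $\mathcal A\in\mathbb R^{n\times\cdots\times n}$ with entries $\mathcal A_i$, $i\in[n]^d$, let $\|\mathcal A\|_F=\big(\sum_i \mathcal A_i^2\big)^{1/2}$ and let $\|\mathcal A\|_2=\sup\big|\sum_{i\in[n]^d}\mathcal A_i\,(x_1)_{i_1}\cdots(x_d)_{i_d}\big|$, the supremum being over all Euclidean unit vectors $x_1,\dots,x_d\in\mathbb R^n$. For a real parameter $s>0$ the sparsification algorithm returns a random tensor $\widetilde{\mathcal A}$ of the same size whose entries are chosen independently of each other as follows. \begin{itemize} \item If $\mathcal A_i^2\ge \|\mathcal A\|_F^2/s$, then $\widetilde{\mathcal A}_i=\mathcal A_i$. \item Else, if $\mathcal A_i^2\le \frac{\ln^2 n}{n^{d/2}}\cdot\frac{\|\mathcal A\|_F^2}{s}$, then $\widetilde{\mathcal A}_i=0$. \item Else, with $p_i=s\mathcal A_i^2/\|\mathcal A\|_F^2$, $\widetilde{\mathcal A}_i=\mathcal A_i/p_i$ with probability $p_i$ and $\widetilde{\mathcal A}_i=0$ with probability $1-p_i$. \end{itemize} \textbf{Theorem.} There are absolute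 constants $c,C,c',C'>0$ such that the following hold. \begin{enumerate} \item For all integers $n\ge 300$ and $2\le d\le 0.5\ln n$, every order-$d$ tensor $\mathcal A\in\mathbb R^{n\times\cdots\times n}$ and every $s>0$, with probability at least $1-1/n$, $$\|\mathcal A-\widetilde{\mathcal A}\|_2\le c\,d^{3/2}\,8^d\sqrt{\frac{n^{d/2}\ln^3 n}{s}}\;\|\mathcal A\|_F .$$ \item For all such $n,d,\mathcal A$, every $\epsilon>0$ and every $s\ge C\,\dfrac{d^3\,64^d\,n^{d/2}\ln^3 n}{\epsilon^2}$, with probability at least $1-1/n$, $\|\mathcal A-\widetilde{\mathcal A}\|_2\le\epsilon\|\mathcal A\|_F$. \item (Matrices, $d=2$.) For all $n\ge 300$, every matrix $M\in\mathbb R^{n\times n}$ and every $s>0$, the output $\widetilde M$ of the algorithm on $M$ (as an order-2 tensor) satisfies, with probability at least $1-1/n$, $$\|M-\widetilde M\|_2\le c'\sqrt{\frac{n\ln^3 n}{s}}\;\|M\|_F ,$$ where $\|\cdot\|_2$ is the usual spectral (operator) norm of a matrix. \item For all such $n,M$, every $\epsilon>0$ and every $s\ge C'\,n\ln^3 n/\epsilon^2$,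 with probability at least $1-1/n$, $\|M-\widetilde M\|_2\le\epsilon\|M\|_F$. \end{enumerate} -/

import Mathlib

open MeasureTheory

/-- Real tensors of order `d` with all `d` modes of dimension `n`. -/
abbrev Tensor (d n : ℕ) : Type := (Fin d → Fin n) → ℝ

namespace Tensor

variable {d n : ℕ}

/-- The Frobenius norm: the square root of the sum of the squares of the entries. -/
noncomputable def frobNorm (A : Tensor d n) : ℝ := Real.sqrt (∑ i, A i ^ 2)

/-- The full contraction of `A` with `x 0` in the first mode, `x 1` in the second mode, and so
on. -/
noncomputable def contract (A : Tensor d n) (x : Fin d → EuclideanSpace ℝ (Fin n)) : ℝ :=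
  ∑ i, A i * ∏ j, x j (i j)

/-- The spectral norm: the supremum of the absolute values of the full contractions with
Euclidean unit vectors. -/
noncomputable def spectralNorm (A : Tensor d n) : ℝ :=
  sSup {r | ∃ x : Fin d → EuclideanSpace ℝ (Fin n), (∀ j, ‖x j‖ = 1) ∧ r = |A.contract x|}

/-- The set in the definition of the spectral norm is bounded, so that its `sSup` is a genuine
supremum as soon as `0 < n`. -/
theorem bddAbove_contract (A : Tensor d n) :
    BddAbove {r | ∃ x : Fin d → EuclideanSpace ℝ (Fin n),
      (∀ j, ‖x j‖ = 1) ∧ r = |A.contract x|} := by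
  refine ⟨∑ i, |A i|, ?_⟩
  rintro r ⟨x, hx, rfl⟩
  refine (Finset.abs_sum_le_sum_abs _ _).trans (Finset.sum_le_sum fun i _ => ?_)
  rw [abs_mul, Finset.abs_prod]
  refine mul_le_of_le_one_right (abs_nonneg _)
    (Finset.prod_le_one (fun _ _ => abs_nonneg _) fun j _ => ?_)
  have h := EuclideanSpace.norm_eq (x j)
  have h2 := PiLp.norm_apply_le (x j) (i j)
  rw [hx j] at h2
  simpa using h2

/-- The law of the output of the sparsification step on a single entry `a`. Here `F` is the
squared Frobenius norm of the whole tensor, `s` is the sampling parameter and `τ` is the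
(relative) threshold below which entries are dropped. -/
noncomputable def entryLaw (F s τ a : ℝ) : Measure ℝ :=
  if F / s ≤ a ^ 2 then Measure.dirac a
  else if a ^ 2 ≤ τ * (F / s) then Measure.dirac 0
  else ENNReal.ofReal (s * a ^ 2 / F) • Measure.dirac (a / (s * a ^ 2 / F)) +
    ENNReal.ofReal (1 - s * a ^ 2 / F) • Measure.dirac 0

/-- The law of the random tensor returned by the sparsification algorithm on input `A` with
sampling parameter `s`: the entries are treated independently of each other. -/
noncomputable def sparsifyLaw (A : Tensor d n) (s : ℝ) : Measure (Tensor d n) :=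
  Measure.pi fun i =>
    entryLaw (A.frobNorm ^ 2) s (Real.log n ^ 2 / (n : ℝ) ^ ((d : ℝ) / 2)) (A i)

theorem isProbabilityMeasure_entryLaw {F : ℝ} (hF : 0 ≤ F) (s τ a : ℝ) :
    IsProbabilityMeasure (entryLaw F s τ a) := by
  unfold entryLaw
  split_ifs with h₁ h₂
  · infer_instance
  · infer_instance
  · have hs : 0 < s := by
      by_contra hs
      exact h₁ ((div_nonpos_of_nonneg_of_nonpos hF (not_lt.mp hs)).trans (sq_nonneg a))
    have hp₀ : 0 ≤ s * a ^ 2 / F := by positivity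
    have hp₁ : s * a ^ 2 / F ≤ 1 := by
      refine div_le_one_of_le₀ ?_ hF
      have := (lt_div_iff₀ hs).mp (not_le.mp h₁)
      linarith
    constructor
    simp only [Measure.coe_add, Measure.coe_smul, Pi.add_apply, Pi.smul_apply,
      measure_univ, smul_eq_mul, mul_one]
    rw [← ENNReal.ofReal_add hp₀ (by linarith)]
    simp

instance (A : Tensor d n) (s : ℝ) : IsProbabilityMeasure (A.sparsifyLaw s) := by
  have := fun i => isProbabilityMeasure_entryLaw (sq_nonneg A.frobNorm) s
    (Real.log n ^ 2 / (n : ℝ) ^ ((d : ℝ) / 2)) (A i)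
  unfold sparsifyLaw
  infer_instance

/-- A square matrix as a tensor of order two. -/
def ofMatrix (M : Matrix (Fin n) (Fin n) ℝ) : Tensor 2 n := fun i => M (i 0) (i 1)

/-- A tensor of order two as a square matrix. -/
def toMatrix (T : Tensor 2 n) : Matrix (Fin n) (Fin n) ℝ := Matrix.of fun i j => T ![i, j]

end Tensor

/-- The Frobenius norm of a square matrix. -/
noncomputable def matrixFrobNorm {n : ℕ} (M : Matrix (Fin n) (Fin n) ℝ) : ℝ :=
  Real.sqrt (∑ i, ∑ j, M i j ^ 2)

/-- The spectral norm of a square matrix: its operator norm on Euclidean space. -/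
noncomputable def matrixSpectralNorm {n : ℕ} (M : Matrix (Fin n) (Fin n) ℝ) : ℝ :=
  ‖Matrix.toEuclideanCLM (n := Fin n) (𝕜 := ℝ) M‖

/-! ### Exponential moments -/

/-! Split `A - T` into a bias `A - mean` and a centred part `mean - T`. Only dropped entries are
biased. There are at most `n ^ d` of them, each with square at most `τ F / s`, where `F = ‖A‖_F ^ 2`
and `τ` is the relative threshold; the Frobenius norm of the bias is then already small enough.

For the centred part, every unit vector lies in the convex hull of vectors with entries `0, ± 2 ^
(-k)` and squared norm at most 5, so by multilinearity only tuples of such vectors matter. The form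
is split into about `log n` levels according to the smallest factor `2 ^ (-m)` of each product. On
level `m` the log-cardinality of the net is of order `4 ^ m log n` (`card_net_le`), while the
smallest factor gains `4 ^ (-m)` in the variance (`sum_levelCoeff_sq_mul_le`). The two cancel, so
one deviation bound serves all levels.

Rescaled entries `a / p` can be too large for a direct Chernoff bound. Instead `exp (l Y - l² Y²)`
is integrated, which gives a subgaussian tail on the event that the empirical quadratic variation is
bounded (`measureReal_sum_mul_ge_le`). That event follows from a bound on the sum of squares along
every one-dimensional fiber (`measureReal_fiber_le`), and this is what the dropping threshold makes
possible. -/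

theorem exp_sub_sq_le (x : ℝ) : Real.exp (x - x ^ 2) ≤ 1 + x + x ^ 2 := by
  -- Bound the reciprocal `exp (x² - x)` below by `1 - x + x²`, and use `(1 + x + x²)(1 - x + x²) =
  -- 1 + x² + x⁴ ≥ 1`.
  have h := Real.add_one_le_exp (x ^ 2 - x)
  have h1 : 0 < x ^ 2 - x + 1 := by nlinarith [sq_nonneg (x - 1 / 2)]
  have h2 : Real.exp (x - x ^ 2) * Real.exp (x ^ 2 - x) = 1 := by
    rw [← Real.exp_add]; simp
  have h3 : Real.exp (x - x ^ 2) * (x ^ 2 - x + 1) ≤ 1 :=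
    (mul_le_mul_of_nonneg_left h (Real.exp_pos _).le).trans_eq h2
  have h4 : 1 ≤ (1 + x + x ^ 2) * (x ^ 2 - x + 1) := by nlinarith [sq_nonneg x, sq_nonneg (x ^ 2)]
  exact le_of_mul_le_mul_right (h3.trans h4) h1

theorem exp_le_one_add_two_mul {x : ℝ} (h0 : 0 ≤ x) (h1 : x ≤ 1) : Real.exp x ≤ 1 + 2 * x := by
  have h := Real.abs_exp_sub_one_le (x := x) (by rwa [abs_of_nonneg h0])
  rw [abs_of_nonneg h0] at h
  linarith [le_abs_self (Real.exp x - 1)]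

/-- Chernoff bound for a sum of functions of independent coordinates. -/
theorem measureReal_pi_le_exp {ι : Type*} [Fintype ι] (μ : ι → Measure ℝ)
    [∀ i, IsProbabilityMeasure (μ i)] (f : ι → ℝ → ℝ) (c : ι → ℝ)
    (hint : ∀ i, Integrable (fun y => Real.exp (f i y)) (μ i))
    (hf : ∀ i, ∫ y, Real.exp (f i y) ∂μ i ≤ Real.exp (c i)) (t : ℝ) :
    (Measure.pi μ).real {T | t ≤ ∑ i, f i (T i)} ≤ Real.exp (∑ i, c i - t) := by
  have hI : Integrable (fun T : ι → ℝ => ∏ i, Real.exp (f i (T i))) (Measure.pi μ) :=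
    Integrable.fintype_prod hint
  have hM := mul_meas_ge_le_integral_of_nonneg (μ := Measure.pi μ)
    (ae_of_all _ fun T => Finset.prod_nonneg fun i _ => (Real.exp_pos (f i (T i))).le) hI
    (Real.exp t)
  rw [integral_fintype_prod_eq_prod (μ := μ) fun i y => Real.exp (f i y)] at hM
  have hle := hM.trans (Finset.prod_le_prod
    (fun i _ => integral_nonneg fun _ => (Real.exp_pos _).le) fun i _ => hf i)
  simp_rw [← Real.exp_sum, Real.exp_le_exp] at hle
  rw [sub_eq_add_neg, Real.exp_add, Real.exp_neg, ← div_eq_mul_inv, le_div_iff₀ (Real.exp_pos _),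
    mul_comm]
  exact hle

/-- Chernoff bound for a sum over a subset of the coordinates. -/
theorem measureReal_pi_le_exp_finset {ι : Type*} [Fintype ι] (μ : ι → Measure ℝ)
    [∀ i, IsProbabilityMeasure (μ i)] (f : ι → ℝ → ℝ) (c : ι → ℝ) (s : Finset ι)
    (hint : ∀ i, Integrable (fun y => Real.exp (f i y)) (μ i))
    (hf : ∀ i, ∫ y, Real.exp (f i y) ∂μ i ≤ Real.exp (c i)) (t : ℝ) :
    (Measure.pi μ).real {T | t ≤ ∑ i ∈ s, f i (T i)} ≤ Real.exp (∑ i ∈ s, c i - t) := by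
  classical
  -- Coordinates outside `s` contribute the zero function, with exponential moment 1.
  have h := measureReal_pi_le_exp μ (fun i y => if i ∈ s then f i y else 0)
    (fun i => if i ∈ s then c i else 0) (fun i => ?_) (fun i => ?_) t
  · simpa [Finset.sum_ite_mem] using h
  · by_cases hi : i ∈ s
    · simpa [hi] using hint i
    · simp [hi]
  · by_cases hi : i ∈ s
    · simpa [hi] using hf i
    · simp [hi]

/-! ### The law of one entry -/

namespace Tensor

/-- The mean of the sparsified entry: `0` for the entries that are dropped because they are small,
and the entry itself otherwise. -/
noncomputable def entryMean (F s τ a : ℝ) : ℝ :=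
  if F / s ≤ a ^ 2 then a else if a ^ 2 ≤ τ * (F / s) then 0 else a

theorem sq_sub_entryMean_le {F s τ : ℝ} (hF : 0 ≤ F) (hs : 0 < s) (hτ : 0 ≤ τ) (a : ℝ) :
    (a - entryMean F s τ a) ^ 2 ≤ τ * (F / s) := by
  have : 0 ≤ τ * (F / s) := by positivity
  unfold entryMean
  split_ifs <;> simp_all

theorem integrable_entryLaw (F s τ a : ℝ) (g : ℝ → ℝ) : Integrable g (entryLaw F s τ a) := by
  have h (x : ℝ) : Integrable g (Measure.dirac x) := integrable_dirac (by simp)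
  unfold entryLaw
  split_ifs
  · exact h _
  · exact h _
  · exact ((h _).smul_measure (by simp)).add_measure ((h _).smul_measure (by simp))

/-- Either the sparsified entry is constantly equal to its mean, or the entry is sampled with a
probability `p ∈ (τ, 1)`. -/
theorem entryLaw_cases {F s : ℝ} (hF : 0 ≤ F) (hs : 0 < s) {τ : ℝ} (hτ : 0 < τ) (a : ℝ) :
    (entryLaw F s τ a = Measure.dirac (entryMean F s τ a)) ∨
    ∃ p : ℝ, 0 < F / s ∧ τ < p ∧ p < 1 ∧ a ^ 2 = p * (F / s) ∧ entryMean F s τ a = a ∧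
      ∀ g : ℝ → ℝ, ∫ y, g y ∂entryLaw F s τ a = p * g (a / p) + (1 - p) * g 0 := by
  by_cases h₁ : F / s ≤ a ^ 2
  · left; simp [entryLaw, entryMean, h₁]
  by_cases h₂ : a ^ 2 ≤ τ * (F / s)
  · left; simp [entryLaw, entryMean, h₁, h₂]
  right
  push Not at h₁ h₂
  have hFs : 0 < F / s := (sq_nonneg a).trans_lt h₁
  have hF' : 0 < F := by
    rcases hF.eq_or_lt with h | h
    · simp [← h] at hFs
    · exact h
  have hp : a ^ 2 = s * a ^ 2 / F * (F / s) := by field_simp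
  set p := s * a ^ 2 / F with hpdef
  have hp1 : p < 1 := by
    rw [hp] at h₁; nlinarith
  have hpτ : τ < p := by
    rw [hp] at h₂; exact lt_of_mul_lt_mul_right h₂ hFs.le
  refine ⟨p, hFs, hpτ, hp1, hp, ?_, fun g => ?_⟩
  · simp [entryMean, h₁.not_ge, h₂.not_ge]
  · have h (x : ℝ) : Integrable g (Measure.dirac x) := integrable_dirac (by simp)
    rw [entryLaw, if_neg h₁.not_ge, if_neg h₂.not_ge, integral_add_measure
      ((h _).smul_measure (by simp)) ((h _).smul_measure (by simp)), integral_smul_measure,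
      integral_smul_measure, integral_dirac, integral_dirac, ← hpdef,
      ENNReal.toReal_ofReal (by linarith), ENNReal.toReal_ofReal (by linarith)]
    simp

/-- Self-normalised subgaussian bound for the centred sparsified entry. -/
theorem integral_exp_sub_sq_entryLaw_le {F s : ℝ} (hF : 0 ≤ F) (hs : 0 < s) {τ : ℝ} (hτ : 0 < τ)
    (a l : ℝ) :
    ∫ y, Real.exp (l * (y - entryMean F s τ a) - (l * (y - entryMean F s τ a)) ^ 2)
      ∂entryLaw F s τ a ≤ Real.exp (l ^ 2 * (F / s)) := by
  rcases entryLaw_cases hF hs hτ a with h | ⟨p, hFs, hpτ, hp1, hp, hm, h⟩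
  · rw [h, integral_dirac]
    simp only [sub_self, mul_zero, zero_pow two_ne_zero]
    exact Real.exp_le_exp.2 (by positivity)
  · have hp0 : 0 < p := hτ.trans hpτ
    rw [h, hm]
    have h1 := mul_le_mul_of_nonneg_left (exp_sub_sq_le (l * (a / p - a))) hp0.le
    have h2 := mul_le_mul_of_nonneg_left (exp_sub_sq_le (l * (0 - a))) (sub_nonneg.2 hp1.le)
    refine (add_le_add h1 h2).trans (le_trans ?_ (Real.add_one_le_exp _))
    -- The linear terms cancel by centring; what remains is the variance `a² (1 - p) / p = (F / s)(1
    -- - p)`.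
    have h3 : p * (1 + l * (a / p - a) + (l * (a / p - a)) ^ 2) +
        (1 - p) * (1 + l * (0 - a) + (l * (0 - a)) ^ 2) = 1 + l ^ 2 * (a ^ 2 * (1 - p) / p) := by
      field_simp; ring
    rw [h3, hp]
    have h4 : p * (F / s) * (1 - p) / p = (F / s) * (1 - p) := by field_simp
    rw [h4]
    have : 0 ≤ l ^ 2 * ((F / s) * p) := by positivity
    nlinarith

/-- Exponential moment of the square of the centred sparsified entry. -/
theorem integral_exp_sq_entryLaw_le {F s : ℝ} (hF : 0 ≤ F) (hs : 0 < s) {τ : ℝ} (hτ : 0 < τ)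
    (a : ℝ) :
    ∫ y, Real.exp (τ * s / F * (y - entryMean F s τ a) ^ 2) ∂entryLaw F s τ a ≤
      Real.exp (2 * τ) := by
  rcases entryLaw_cases hF hs hτ a with h | ⟨p, hFs, hpτ, hp1, hp, hm, h⟩
  · rw [h, integral_dirac]
    simp only [sub_self, mul_zero, zero_pow two_ne_zero]
    exact Real.exp_le_exp.2 (by positivity)
  · have hp0 : 0 < p := hτ.trans hpτ
    have hF' : 0 < F := by
      rcases hF.eq_or_lt with h | h
      · simp [← h] at hFs
      · exact h
    rw [h, hm]
    have e1 : τ * s / F * (a / p - a) ^ 2 = τ * (1 - p) ^ 2 / p := by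
      have : (a / p - a) ^ 2 = a ^ 2 * (1 - p) ^ 2 / p ^ 2 := by field_simp
      rw [this, hp]; field_simp
    have e2 : τ * s / F * (0 - a) ^ 2 = τ * p := by
      rw [zero_sub, neg_sq, hp]; field_simp
    rw [e1, e2]
    -- Here `τ < p` enters: dropping small entries bounds the normalised square of every sampled
    -- one.
    have b1 : τ * (1 - p) ^ 2 / p ≤ 1 := by
      have : (1 - p) ^ 2 ≤ 1 := by nlinarith
      rw [div_le_one hp0]; nlinarith
    have b2 : τ * p ≤ 1 := by nlinarith
    have h1 := mul_le_mul_of_nonneg_left (exp_le_one_add_two_mul (by positivity) b1) hp0.le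
    have h2 := mul_le_mul_of_nonneg_left (exp_le_one_add_two_mul (by positivity) b2)
      (sub_nonneg.2 hp1.le)
    refine (add_le_add h1 h2).trans (le_trans ?_ (Real.add_one_le_exp _))
    have h3 : p * (1 + 2 * (τ * (1 - p) ^ 2 / p)) + (1 - p) * (1 + 2 * (τ * p)) =
        1 + 2 * τ * (1 - p) := by
      field_simp; ring
    rw [h3]
    nlinarith

/-! ### The multilinear form of a tensor and the dyadic net -/

variable {d n : ℕ}

/-- The full contraction of a tensor, as a multilinear form. -/
noncomputable def form (B : Tensor d n) : MultilinearMap ℝ (fun _ : Fin d => Fin n → ℝ) ℝ :=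
  ∑ i, B i • (MultilinearMap.mkPiAlgebra ℝ (Fin d) ℝ).compLinearMap
    fun j => (LinearMap.proj (i j) : (Fin n → ℝ) →ₗ[ℝ] ℝ)

theorem form_apply (B : Tensor d n) (x : Fin d → Fin n → ℝ) :
    B.form x = ∑ i, B i * ∏ j, x j (i j) := by
  simp [form]

/-- The real numbers `0` and `± 2 ^ (-k)` for `k < m`. -/
noncomputable def dyadic (m : ℕ) : Finset ℝ :=
  insert 0 ((Finset.range m).image (fun k => (1 / 2 : ℝ) ^ k) ∪
    (Finset.range m).image (fun k => -(1 / 2 : ℝ) ^ k))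

theorem mem_dyadic {m : ℕ} {y : ℝ} : y ∈ dyadic m ↔ y = 0 ∨ ∃ k < m, |y| = (1 / 2 : ℝ) ^ k := by
  simp only [dyadic, Finset.mem_insert, Finset.mem_union, Finset.mem_image, Finset.mem_range]
  refine or_congr_right ⟨?_, ?_⟩
  · rintro (⟨k, hk, rfl⟩ | ⟨k, hk, rfl⟩) <;> refine ⟨k, hk, ?_⟩
    · exact abs_of_pos (by positivity)
    · rw [abs_neg]; exact abs_of_pos (by positivity)
  · rintro ⟨k, hk, h⟩
    rcases (abs_eq (by positivity)).1 h with h | h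
    · exact Or.inl ⟨k, hk, h.symm⟩
    · exact Or.inr ⟨k, hk, h.symm⟩

/-- Vectors with dyadic entries and Euclidean norm at most `√5`. -/
noncomputable def net (n m : ℕ) : Finset (Fin n → ℝ) :=
  (Fintype.piFinset fun _ => dyadic m).filter fun x => ∑ k, x k ^ 2 ≤ 5

theorem mem_net {m : ℕ} {x : Fin n → ℝ} :
    x ∈ net n m ↔ (∀ k, x k ∈ dyadic m) ∧ ∑ k, x k ^ 2 ≤ 5 := by
  simp [net, Fintype.mem_piFinset]

/-- Every real in `[-1, 1]` lies between two dyadic numbers of comparable size. -/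
theorem exists_dyadic_segment (M : ℕ) {y : ℝ} (hy : |y| ≤ 1) :
    ∃ a b : ℝ, y ∈ segment ℝ a b ∧ ∀ z ∈ ({a, b} : Set ℝ),
      z ∈ dyadic (M + 1) ∧ z ^ 2 ≤ 4 * y ^ 2 + (1 / 4) ^ M := by
  wlog h0 : 0 ≤ y generalizing y
  · obtain ⟨a, b, hab, h⟩ := this (y := -y) (by rwa [abs_neg]) (by linarith)
    refine ⟨-a, -b, ?_, ?_⟩
    · obtain ⟨u, v, hu, hv, huv, e⟩ := hab
      refine ⟨u, v, hu, hv, huv, ?_⟩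
      simp only [smul_eq_mul] at e ⊢
      linarith
    · intro z hz
      have := h (-z) (by
        rcases hz with rfl | hz
        · simp
        · rw [Set.mem_singleton_iff] at hz; simp [hz])
      rw [mem_dyadic, neg_eq_zero, abs_neg, neg_sq, neg_sq, ← mem_dyadic] at this
      exact this
  rw [abs_of_nonneg h0] at hy
  have hsq (k : ℕ) : ((1 / 2 : ℝ) ^ k) ^ 2 = (1 / 4) ^ k := by
    rw [← pow_mul, mul_comm, pow_mul]; norm_num
  have hd (k : ℕ) (hk : k < M + 1) : (1 / 2 : ℝ) ^ k ∈ dyadic (M + 1) :=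
    mem_dyadic.2 (Or.inr ⟨k, hk, abs_of_pos (by positivity)⟩)
  -- Below the finest scale the segment is `[0, 2 ^ (-M)]`, the source of the additive `4 ^ (-M)`.
  -- Otherwise it is `[2 ^ (-k-1), 2 ^ (-k)]`, whose upper end is at most `2 y`.
  by_cases hM : y ≤ (1 / 2) ^ M
  · refine ⟨0, (1 / 2) ^ M, ?_, ?_⟩
    · rw [segment_eq_Icc (by positivity)]; exact ⟨h0, hM⟩
    · rintro z (rfl | hz)
      · exact ⟨mem_dyadic.2 (Or.inl rfl), by rw [zero_pow two_ne_zero]; positivity⟩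
      · rw [Set.mem_singleton_iff] at hz
        subst hz
        refine ⟨hd M (by omega), ?_⟩
        rw [hsq]
        nlinarith [sq_nonneg y]
  · push Not at hM
    obtain ⟨k, hk1, hk2⟩ := exists_nat_pow_near_of_lt_one (lt_of_le_of_lt (by positivity) hM) hy
      (by norm_num : (0 : ℝ) < 1 / 2) (by norm_num)
    have hkM : k < M := by
      by_contra h
      push Not at h
      exact absurd hk2 (not_le.2 ((pow_le_pow_of_le_one (by norm_num) (by norm_num) h).trans_lt hM))
    have e : (1 / 2 : ℝ) ^ k = 2 * (1 / 2) ^ (k + 1) := by rw [pow_succ]; ring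
    have hp : (0 : ℝ) < (1 / 2) ^ (k + 1) := by positivity
    have hp' : (0 : ℝ) ≤ (1 / 4) ^ M := by positivity
    refine ⟨(1 / 2) ^ (k + 1), (1 / 2) ^ k, ?_, ?_⟩
    · rw [segment_eq_Icc (by linarith)]; exact ⟨hk1.le, hk2⟩
    · rintro z (rfl | hz)
      · exact ⟨hd _ (by omega), by nlinarith⟩
      · rw [Set.mem_singleton_iff] at hz
        subst hz
        exact ⟨hd _ (by omega), by rw [e]; nlinarith⟩

/-- A box is the hull of its vertices. Rounding each coordinate to an end of its dyadic segment
gives squared norm at most `4 ∑ x² + n 4 ^ (-M) ≤ 5`. -/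
theorem mem_convexHull_net {M : ℕ} (hM : (n : ℝ) * (1 / 4) ^ M ≤ 1) {x : Fin n → ℝ}
    (hx : ∑ k, x k ^ 2 ≤ 1) : x ∈ convexHull ℝ (net n (M + 1) : Set (Fin n → ℝ)) := by
  have h1 (k : Fin n) : |x k| ≤ 1 := by
    rw [← sq_le_one_iff_abs_le_one]
    exact (Finset.single_le_sum (f := fun k => x k ^ 2) (fun _ _ => sq_nonneg _)
      (Finset.mem_univ k)).trans hx
  choose a b hab h using fun k => exists_dyadic_segment M (h1 k)
  have hx' : x ∈ convexHull ℝ (Set.univ.pi fun k => ({a k, b k} : Set ℝ)) :=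
    mem_convexHull_pi fun k _ => by rw [convexHull_pair]; exact hab k
  refine convexHull_mono ?_ hx'
  intro z hz
  have hz' (k) := h k (z k) (hz k trivial)
  refine mem_net.2 ⟨fun k => (hz' k).1, ?_⟩
  calc ∑ k, z k ^ 2 ≤ ∑ k, (4 * x k ^ 2 + (1 / 4) ^ M) :=
        Finset.sum_le_sum fun k _ => (hz' k).2
    _ = 4 * ∑ k, x k ^ 2 + n * (1 / 4) ^ M := by
        rw [Finset.sum_add_distrib, ← Finset.mul_sum]; simp
    _ ≤ 5 := by linarith

/-- The maximum principle for multilinear forms. -/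
theorem exists_abs_le_of_mem_convexHull
    (f : MultilinearMap ℝ (fun _ : Fin d => Fin n → ℝ) ℝ) (S : Set (Fin n → ℝ))
    (x : Fin d → Fin n → ℝ) (hx : ∀ j, x j ∈ convexHull ℝ S) :
    ∃ y : Fin d → Fin n → ℝ, (∀ j, y j ∈ S) ∧ |f x| ≤ |f y| := by
  classical
  suffices h : ∀ J : Finset (Fin d), ∃ y : Fin d → Fin n → ℝ,
      (∀ j ∈ J, y j ∈ S) ∧ (∀ j, y j ∈ convexHull ℝ S) ∧ |f x| ≤ |f y| by
    obtain ⟨y, h1, -, h2⟩ := h Finset.univ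
    exact ⟨y, fun j => h1 j (Finset.mem_univ j), h2⟩
  intro J
  induction J using Finset.induction_on with
  | empty => exact ⟨x, by simp, hx, le_rfl⟩
  | insert j J hj ih =>
    obtain ⟨y, h1, h2, h3⟩ := ih
    -- With the other slots frozen, `|f|` is convex in slot `j`, so some point of `S` does at least
    -- as well; slots are replaced one at a time.
    have hconv : ConvexOn ℝ Set.univ fun v => |f.toLinearMap y j v| :=
      (convexOn_univ_norm (E := ℝ)).comp_linearMap (f.toLinearMap y j)
    obtain ⟨v, hv, hle⟩ := hconv.exists_ge_of_mem_convexHull (Set.subset_univ S) (h2 j)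
    simp only [MultilinearMap.toLinearMap_apply, Function.update_eq_self] at hle
    refine ⟨Function.update y j v, fun k hk => ?_, fun k => ?_, h3.trans hle⟩
    · rcases eq_or_ne k j with rfl | hkj
      · simpa using hv
      · rw [Function.update_of_ne hkj]
        exact h1 k ((Finset.mem_insert.1 hk).resolve_left hkj)
    · rcases eq_or_ne k j with rfl | hkj
      · simpa using subset_convexHull ℝ S hv
      · rw [Function.update_of_ne hkj]; exact h2 k

/-! ### Decomposition by the smallest factor -/

open Classical in
/-- The coefficients of the part of the form in which the smallest factor is `2 ^ (-m)`, for
vectors whose nonzero entries are at least `2 ^ (-m)` in absolute value. -/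
noncomputable def levelCoeff (m : ℕ) (x : Fin d → Fin n → ℝ) (i : Fin d → Fin n) : ℝ :=
  if ∃ j, |x j (i j)| = (1 / 2 : ℝ) ^ m then ∏ j, x j (i j) else 0

/-- Replace the entries of absolute value `2 ^ (-m)` by zero. -/
noncomputable def dropLevel (m : ℕ) (x : Fin n → ℝ) : Fin n → ℝ :=
  fun k => if |x k| = (1 / 2 : ℝ) ^ m then 0 else x k

theorem dropLevel_mem_net {m : ℕ} {x : Fin n → ℝ} (hx : x ∈ net n (m + 1)) :
    dropLevel m x ∈ net n m := by
  rw [mem_net] at hx ⊢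
  refine ⟨fun k => ?_, le_trans (Finset.sum_le_sum fun k _ => ?_) hx.2⟩
  · have := hx.1 k
    rw [mem_dyadic] at this ⊢
    unfold dropLevel
    split_ifs with h
    · exact Or.inl rfl
    · rcases this with h0 | ⟨l, hl, e⟩
      · exact Or.inl h0
      · refine Or.inr ⟨l, lt_of_le_of_ne (Nat.lt_succ_iff.1 hl) ?_, e⟩
        rintro rfl
        exact h e
  · unfold dropLevel
    split_ifs
    · rw [zero_pow two_ne_zero]; positivity
    · exact le_rfl

/-- Dropping entries of modulus `2 ^ (-m)` kills exactly the products with such a factor and leaves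
the others unchanged. -/
theorem form_eq_levelCoeff_add (B : Tensor d n) (m : ℕ) (x : Fin d → Fin n → ℝ) :
    B.form x = ∑ i, levelCoeff m x i * B i + B.form fun j => dropLevel m (x j) := by
  rw [form_apply, form_apply, ← Finset.sum_add_distrib]
  refine Finset.sum_congr rfl fun i _ => ?_
  unfold levelCoeff dropLevel
  split_ifs with h
  · obtain ⟨j, hj⟩ := h
    have h0 : (∏ j, if |x j (i j)| = (1 / 2 : ℝ) ^ m then 0 else x j (i j)) = 0 :=
      Finset.prod_eq_zero (Finset.mem_univ j) (if_pos hj)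
    rw [h0]
    ring
  · push Not at h
    rw [Finset.prod_congr rfl fun j _ => if_neg (h j)]
    ring

/-- Peel off the finest level repeatedly: `dropLevel` sends the net with `m + 1` scales to the net
with `m`. -/
theorem abs_form_le_of_levelCoeff (hd : 0 < d) (B : Tensor d n) {t : ℝ} (M : ℕ)
    (h : ∀ m < M, ∀ x : Fin d → Fin n → ℝ, (∀ j, x j ∈ net n (m + 1)) →
      |∑ i, levelCoeff m x i * B i| ≤ t)
    (x : Fin d → Fin n → ℝ) (hx : ∀ j, x j ∈ net n M) : |B.form x| ≤ M * t := by
  induction M generalizing x with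
  | zero =>
    -- With no scales left the net contains only the zero vector; `0 < d` provides a slot for it.
    have : x ⟨0, hd⟩ = 0 := by
      funext k
      have := (mem_net.1 (hx ⟨0, hd⟩)).1 k
      simpa [mem_dyadic] using this
    rw [B.form.map_coord_zero ⟨0, hd⟩ this]
    simp
  | succ M ih =>
    rw [form_eq_levelCoeff_add B M x]
    have h1 := h M (Nat.lt_succ_self M) x hx
    have h2 := ih (fun m hm => h m (hm.trans (Nat.lt_succ_self M))) (fun j => dropLevel M (x j))
      fun j => dropLevel_mem_net (hx j)
    refine (abs_add_le _ _).trans ?_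
    push_cast
    linarith

/-- The weighted sum of the squared level coefficients, in terms of the sums of the weights along
the fibers of the tensor. -/
theorem sum_levelCoeff_sq_mul_le {e : ℕ} (m : ℕ) (x : Fin (e + 1) → Fin n → ℝ)
    (hx : ∀ j, ∑ k, x j k ^ 2 ≤ 5) (w : Tensor (e + 1) n) (hw : ∀ i, 0 ≤ w i) {r : ℝ} (hr : 0 ≤ r)
    (h : ∀ (J : Fin (e + 1)) (i : Fin e → Fin n), ∑ k, w (J.insertNth k i) ≤ r) :
    ∑ i, levelCoeff m x i ^ 2 * w i ≤ (e + 1) * ((1 / 4) ^ m * 5 ^ e * r) := by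
  -- Charge `i` to a mode `J` whose factor is `2 ^ (-m)`, then sum over all `J`. The bound no longer
  -- involves `x J`, so `w` can be summed along the fibers in direction `J`.
  have h1 (i : Fin (e + 1) → Fin n) : levelCoeff m x i ^ 2 * w i ≤
      ∑ J : Fin (e + 1), (1 / 4) ^ m * (∏ j, x (J.succAbove j) (i (J.succAbove j)) ^ 2) * w i := by
    have hnn (J : Fin (e + 1)) :
        0 ≤ (1 / 4) ^ m * (∏ j, x (J.succAbove j) (i (J.succAbove j)) ^ 2) * w i :=
      mul_nonneg (by positivity) (hw i)
    unfold levelCoeff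
    split_ifs with hJ
    · obtain ⟨J, hJ⟩ := hJ
      refine le_trans (le_of_eq ?_) (Finset.single_le_sum (fun J _ => hnn J) (Finset.mem_univ J))
      have e1 : x J (i J) ^ 2 = (1 / 4) ^ m := by
        rw [← sq_abs, hJ, ← pow_mul, mul_comm, pow_mul]; norm_num
      rw [Fin.prod_univ_succAbove _ J, mul_pow, e1, ← Finset.prod_pow]
    · simpa using Finset.sum_nonneg fun J _ => hnn J
  refine (Finset.sum_le_sum fun i _ => h1 i).trans ?_
  rw [Finset.sum_comm]
  refine (Finset.sum_le_card_nsmul _ _ ((1 / 4) ^ m * 5 ^ e * r) fun J _ => ?_).trans_eq (by simp)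
  rw [← (Fin.insertNthEquiv (fun _ => Fin n) J).sum_comp, Fintype.sum_prod_type_right]
  simp only [Fin.insertNthEquiv_apply, Fin.insertNth_apply_succAbove]
  calc ∑ i : Fin e → Fin n, ∑ k : Fin n,
        (1 / 4) ^ m * (∏ j, x (J.succAbove j) (i j) ^ 2) * w (J.insertNth k i)
      ≤ ∑ i : Fin e → Fin n, (1 / 4) ^ m * (∏ j, x (J.succAbove j) (i j) ^ 2) * r := by
        refine Finset.sum_le_sum fun i _ => ?_
        rw [← Finset.mul_sum]
        exact mul_le_mul_of_nonneg_left (h J i) (by positivity)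
    _ = (1 / 4) ^ m * (∏ j : Fin e, ∑ k, x (J.succAbove j) k ^ 2) * r := by
        rw [← Finset.sum_mul, ← Finset.mul_sum, Finset.prod_univ_sum, Fintype.piFinset_univ]
    _ ≤ (1 / 4) ^ m * 5 ^ e * r := by
        refine mul_le_mul_of_nonneg_right (mul_le_mul_of_nonneg_left ?_ (by positivity)) hr
        refine (Finset.prod_le_prod (fun j _ => Finset.sum_nonneg fun _ _ => sq_nonneg _)
          fun j _ => hx (J.succAbove j)).trans_eq (by simp)

/-! ### The cardinality of the net -/

/-- Weight each vector by `exp (-β ∑ x²)`, which is at least `exp (-5 β)` on the net. Over the full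
grid the weights factorise, and `β = 4 ^ m log n` makes each nonzero value weigh at most `1 / n`, so
the one-dimensional sum is at most `1 + 2 (m + 1) / n`. -/
theorem card_net_le (hn : 0 < n) (m : ℕ) :
    ((net n (m + 1)).card : ℝ) ≤ Real.exp (4 ^ m * (5 * Real.log n + 2)) := by
  set β : ℝ := 4 ^ m * Real.log n with hβ
  have hn' : (1 : ℝ) ≤ n := by exact_mod_cast hn
  have hL : 0 ≤ Real.log n := Real.log_nonneg hn'
  have hβ0 : 0 ≤ β := by positivity
  have hbig (y : ℝ) (hy : y ∈ (dyadic (m + 1)).erase 0) :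
      Real.exp (-(β * y ^ 2)) ≤ (n : ℝ)⁻¹ := by
    rw [Finset.mem_erase, mem_dyadic] at hy
    obtain ⟨k, hk, hyk⟩ := hy.2.resolve_left hy.1
    have : (1 / 4 : ℝ) ^ m ≤ y ^ 2 := by
      rw [← sq_abs, hyk, ← pow_mul, mul_comm, pow_mul]
      norm_num only
      exact pow_le_pow_of_le_one (by norm_num) (by norm_num) (by omega)
    rw [← Real.exp_log (by positivity : (0 : ℝ) < (n : ℝ)⁻¹), Real.log_inv, Real.exp_le_exp,
      neg_le_neg_iff]
    calc Real.log n = β * (1 / 4) ^ m := by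
          rw [hβ, mul_right_comm, ← mul_pow]; norm_num
      _ ≤ β * y ^ 2 := mul_le_mul_of_nonneg_left this hβ0
  have hcard : ((dyadic (m + 1)).erase 0).card ≤ 2 * (m + 1) := by
    unfold dyadic
    refine (Finset.card_le_card (Finset.erase_insert_subset 0 _)).trans
      ((Finset.card_union_le _ _).trans ?_)
    have h1 := Finset.card_image_le (s := Finset.range (m + 1)) (f := fun k => (1 / 2 : ℝ) ^ k)
    have h2 := Finset.card_image_le (s := Finset.range (m + 1)) (f := fun k => -(1 / 2 : ℝ) ^ k)
    rw [Finset.card_range] at h1 h2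
    omega
  have hm : ((m : ℝ) + 1) ≤ 4 ^ m := by
    have : m + 1 ≤ 4 ^ m := Nat.lt_pow_self (by norm_num)
    exact_mod_cast this
  have hsum : ∑ y ∈ dyadic (m + 1), Real.exp (-(β * y ^ 2)) ≤ Real.exp (2 * 4 ^ m / n) := by
    rw [← Finset.add_sum_erase _ _ (mem_dyadic.2 (Or.inl rfl) : (0 : ℝ) ∈ dyadic (m + 1))]
    have h1 := Finset.sum_le_card_nsmul _ _ _ hbig
    have h2 : (((dyadic (m + 1)).erase 0).card : ℝ) ≤ 2 * 4 ^ m := by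
      refine (Nat.cast_le.2 hcard).trans ?_
      push_cast
      linarith
    have h3 : (((dyadic (m + 1)).erase 0).card : ℝ) * (n : ℝ)⁻¹ ≤ 2 * 4 ^ m * (n : ℝ)⁻¹ :=
      mul_le_mul_of_nonneg_right h2 (by positivity)
    rw [nsmul_eq_mul] at h1
    have h4 := Real.add_one_le_exp (2 * 4 ^ m / (n : ℝ))
    rw [div_eq_mul_inv] at h4 ⊢
    rw [zero_pow two_ne_zero]
    simp only [mul_zero, neg_zero, Real.exp_zero]
    linarith
  have key : ((net n (m + 1)).card : ℝ) * Real.exp (-(5 * β)) ≤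
      (∑ y ∈ dyadic (m + 1), Real.exp (-(β * y ^ 2))) ^ n := by
    rw [Finset.sum_pow', ← nsmul_eq_mul]
    refine (Finset.card_nsmul_le_sum _ _ _ fun x hx => ?_).trans
      (Finset.sum_le_sum_of_subset_of_nonneg (Finset.filter_subset _ _)
        fun _ _ _ => Finset.prod_nonneg fun _ _ => (Real.exp_pos _).le)
    rw [← Real.exp_sum, Real.exp_le_exp, Finset.sum_neg_distrib, ← Finset.mul_sum, neg_le_neg_iff,
      mul_comm 5]
    exact mul_le_mul_of_nonneg_left (mem_net.1 hx).2 hβ0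
  have hpow : (∑ y ∈ dyadic (m + 1), Real.exp (-(β * y ^ 2))) ^ n ≤ Real.exp (2 * 4 ^ m) := by
    refine (pow_le_pow_left₀ (Finset.sum_nonneg fun _ _ => (Real.exp_pos _).le) hsum n).trans_eq ?_
    rw [← Real.exp_nat_mul]
    congr 1
    field_simp
  have := key.trans hpow
  rw [Real.exp_neg, ← div_eq_mul_inv, div_le_iff₀ (Real.exp_pos _), ← Real.exp_add] at this
  refine this.trans_eq ?_
  congr 1
  rw [hβ]; ring

/-! ### Tail bounds for the sparsified tensor -/

/-- The relative threshold below which entries are dropped. -/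
noncomputable def threshold (d n : ℕ) : ℝ := Real.log n ^ 2 / (n : ℝ) ^ ((d : ℝ) / 2)

/-- The entrywise mean of the sparsified tensor. -/
noncomputable def mean (A : Tensor d n) (s : ℝ) : Tensor d n :=
  fun i => entryMean (A.frobNorm ^ 2) s (threshold d n) (A i)

theorem measureReal_sum_sq_ge_le (A : Tensor d n) {s : ℝ} (hs : 0 < s) (hτ : 0 < threshold d n)
    (S : Finset (Fin d → Fin n)) (r : ℝ) :
    (A.sparsifyLaw s).real {T | r ≤ ∑ i ∈ S, (T i - A.mean s i) ^ 2} ≤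
      Real.exp (2 * S.card * threshold d n - threshold d n * s / A.frobNorm ^ 2 * r) := by
  have := fun i => isProbabilityMeasure_entryLaw (sq_nonneg A.frobNorm) s
    (Real.log n ^ 2 / (n : ℝ) ^ ((d : ℝ) / 2)) (A i)
  have h := measureReal_pi_le_exp_finset (fun i => entryLaw (A.frobNorm ^ 2) s
      (Real.log n ^ 2 / (n : ℝ) ^ ((d : ℝ) / 2)) (A i))
    (fun i y => threshold d n * s / A.frobNorm ^ 2 * (y - A.mean s i) ^ 2)
    (fun _ => 2 * threshold d n) S (fun i => integrable_entryLaw _ _ _ _ _)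
    (fun i => integral_exp_sq_entryLaw_le (sq_nonneg _) hs hτ (A i))
    (threshold d n * s / A.frobNorm ^ 2 * r)
  refine (measureReal_mono ?_).trans (h.trans_eq ?_)
  · intro T hT
    simp only [Set.mem_ofPred_eq, ← Finset.mul_sum] at hT ⊢
    exact mul_le_mul_of_nonneg_left hT (by positivity)
  · rw [Finset.sum_const, nsmul_eq_mul]
    congr 2
    ring

/-- Self-normalised Chernoff bound: `v` dominates both the expected quadratic variation bound and,
on the event, the empirical one. -/
theorem measureReal_sum_mul_ge_le (A : Tensor d n) {s : ℝ} (hs : 0 < s) (hτ : 0 < threshold d n)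
    (u : Tensor d n) {v : ℝ} (hv : 0 < v) (hu : ∑ i, u i ^ 2 * (A.frobNorm ^ 2 / s) ≤ v) {t : ℝ}
    (ht : 0 ≤ t) :
    (A.sparsifyLaw s).real {T | t ≤ ∑ i, u i * (T i - A.mean s i) ∧
      ∑ i, u i ^ 2 * (T i - A.mean s i) ^ 2 ≤ v} ≤ Real.exp (-(t ^ 2 / (8 * v))) := by
  -- Minimiser of the exponent `2 l² v - l t`.
  set l := t / (4 * v) with hl
  have hl0 : 0 ≤ l := by positivity
  have := fun i => isProbabilityMeasure_entryLaw (sq_nonneg A.frobNorm) s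
    (Real.log n ^ 2 / (n : ℝ) ^ ((d : ℝ) / 2)) (A i)
  have h := measureReal_pi_le_exp (fun i => entryLaw (A.frobNorm ^ 2) s
      (Real.log n ^ 2 / (n : ℝ) ^ ((d : ℝ) / 2)) (A i))
    (fun i y => l * u i * (y - A.mean s i) - (l * u i * (y - A.mean s i)) ^ 2)
    (fun i => (l * u i) ^ 2 * (A.frobNorm ^ 2 / s)) (fun i => integrable_entryLaw _ _ _ _ _)
    (fun i => integral_exp_sub_sq_entryLaw_le (sq_nonneg _) hs hτ (A i) (l * u i))
    (l * t - l ^ 2 * v)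
  refine (measureReal_mono ?_).trans (h.trans ?_)
  · rintro T ⟨h1, h2⟩
    have e : ∑ i, (l * u i * (T i - A.mean s i) - (l * u i * (T i - A.mean s i)) ^ 2) =
        l * ∑ i, u i * (T i - A.mean s i) - l ^ 2 * ∑ i, u i ^ 2 * (T i - A.mean s i) ^ 2 := by
      rw [Finset.sum_sub_distrib, Finset.mul_sum, Finset.mul_sum]
      congr 1 <;> exact Finset.sum_congr rfl fun i _ => by ring
    simp only [Set.mem_ofPred_eq]
    rw [e]
    exact sub_le_sub (mul_le_mul_of_nonneg_left h1 hl0) (mul_le_mul_of_nonneg_left h2 (sq_nonneg l))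
  · rw [Real.exp_le_exp]
    have e : ∑ i, (l * u i) ^ 2 * (A.frobNorm ^ 2 / s) =
        l ^ 2 * ∑ i, u i ^ 2 * (A.frobNorm ^ 2 / s) := by
      rw [Finset.mul_sum]
      exact Finset.sum_congr rfl fun i _ => by ring
    rw [e]
    have h1 := mul_le_mul_of_nonneg_left hu (sq_nonneg l)
    have h2 : l ^ 2 * v + l ^ 2 * v - l * t = -(t ^ 2 / (8 * v)) := by
      rw [hl]; field_simp; ring
    linarith

theorem measureReal_abs_sum_mul_ge_le (A : Tensor d n) {s : ℝ} (hs : 0 < s)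
    (hτ : 0 < threshold d n) (u : Tensor d n) {v : ℝ} (hv : 0 < v)
    (hu : ∑ i, u i ^ 2 * (A.frobNorm ^ 2 / s) ≤ v) {t : ℝ} (ht : 0 ≤ t) :
    (A.sparsifyLaw s).real {T | t ≤ |∑ i, u i * (T i - A.mean s i)| ∧
      ∑ i, u i ^ 2 * (T i - A.mean s i) ^ 2 ≤ v} ≤ 2 * Real.exp (-(t ^ 2 / (8 * v))) := by
  have h1 := measureReal_sum_mul_ge_le A hs hτ u hv hu ht
  have h2 := measureReal_sum_mul_ge_le A hs hτ (fun i => -u i) hv (by simpa using hu) ht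
  refine le_trans (measureReal_mono ?_) ((measureReal_union_le _ _).trans
    ((add_le_add h1 h2).trans_eq (two_mul _).symm))
  rintro T ⟨h1, h2⟩
  rcases le_abs.1 h1 with h | h
  · exact Or.inl ⟨h, h2⟩
  · exact Or.inr ⟨by simpa [Finset.sum_neg_distrib] using h, by simpa using h2⟩

/-- The radius of the deviations on each level of the dyadic decomposition. -/
noncomputable def deviation (e n : ℕ) (r : ℝ) : ℝ :=
  Real.sqrt (8 * (e + 1) * 5 ^ e * r * ((e + 1) * (5 * Real.log n + 2) + 3 * Real.log n))

/-- The condition `hr` makes each fiber fail with probability at most `n ^ (-(e + 3))`; there are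
`(e + 1) n ^ e` fibers. -/
theorem measureReal_fiber_le {e : ℕ} (A : Tensor (e + 1) n) (hn : 0 < n) {s : ℝ} (hs : 0 < s)
    (hτ : 0 < threshold (e + 1) n) {r : ℝ}
    (hr : 2 * n * threshold (e + 1) n + (e + 3) * Real.log n ≤
      threshold (e + 1) n * s / A.frobNorm ^ 2 * r) :
    (A.sparsifyLaw s).real {T | ∃ (J : Fin (e + 1)) (i : Fin e → Fin n),
      r < ∑ k, (T (J.insertNth k i) - A.mean s (J.insertNth k i)) ^ 2} ≤ (e + 1) / (n : ℝ) ^ 3 := by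
  have hn' : (0 : ℝ) < n := by exact_mod_cast hn
  have hfib (J : Fin (e + 1)) (i : Fin e → Fin n) : (A.sparsifyLaw s).real
      {T | r ≤ ∑ k, (T (J.insertNth k i) - A.mean s (J.insertNth k i)) ^ 2} ≤
      ((n : ℝ) ^ (e + 3))⁻¹ := by
    have hinj : Function.Injective fun k : Fin n => (J.insertNth k i : Fin (e + 1) → Fin n) := by
      intro k k' h
      simpa using congrFun h J
    have h := measureReal_sum_sq_ge_le A hs hτ
      (Finset.univ.map ⟨fun k : Fin n => (J.insertNth k i : Fin (e + 1) → Fin n), hinj⟩) r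
    simp only [Finset.sum_map, Function.Embedding.coeFn_mk, Finset.card_map, Finset.card_univ,
      Fintype.card_fin] at h
    refine h.trans ?_
    rw [← Real.exp_log (by positivity : (0 : ℝ) < ((n : ℝ) ^ (e + 3))⁻¹), Real.exp_le_exp,
      Real.log_inv, Real.log_pow]
    push_cast
    linarith
  have hsub : {T : Tensor (e + 1) n | ∃ (J : Fin (e + 1)) (i : Fin e → Fin n),
      r < ∑ k, (T (J.insertNth k i) - A.mean s (J.insertNth k i)) ^ 2} ⊆
      ⋃ p ∈ (Finset.univ : Finset (Fin (e + 1) × (Fin e → Fin n))),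
        {T | r ≤ ∑ k, (T (p.1.insertNth k p.2) - A.mean s (p.1.insertNth k p.2)) ^ 2} := by
    rintro T ⟨J, i, h⟩
    exact Set.mem_biUnion (Finset.mem_coe.2 (Finset.mem_univ (J, i))) h.le
  refine (measureReal_mono hsub (measure_ne_top _ _)).trans ((measureReal_biUnion_finset_le _ _).trans
    ((Finset.sum_le_card_nsmul _ _ _ fun p _ => hfib p.1 p.2).trans_eq ?_))
  simp only [Finset.card_univ, Fintype.card_prod, Fintype.card_fin, Fintype.card_pi,
    Finset.prod_const, nsmul_eq_mul]
  push_cast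
  field_simp
  ring

theorem measureReal_level_le {e : ℕ} (A : Tensor (e + 1) n) (hn : 0 < n) {s : ℝ} (hs : 0 < s)
    (hτ : 0 < threshold (e + 1) n) {r : ℝ} (hr : 0 < r) (hnr : n * (A.frobNorm ^ 2 / s) ≤ r)
    (m : ℕ) :
    (A.sparsifyLaw s).real {T | (∃ x : Fin (e + 1) → Fin n → ℝ, (∀ j, x j ∈ net n (m + 1)) ∧
        deviation e n r < |∑ i, levelCoeff m x i * (T i - A.mean s i)|) ∧
      ∀ (J : Fin (e + 1)) (i : Fin e → Fin n),
        ∑ k, (T (J.insertNth k i) - A.mean s (J.insertNth k i)) ^ 2 ≤ r} ≤ 2 / (n : ℝ) ^ 3 := by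
  have hn' : (0 : ℝ) < n := by exact_mod_cast hn
  have hL : 0 ≤ Real.log n := Real.log_nonneg (by exact_mod_cast hn)
  set v : ℝ := (e + 1) * ((1 / 4) ^ m * 5 ^ e * r) with hv
  have hv0 : 0 < v := by positivity
  have hx (x : Fin (e + 1) → Fin n → ℝ) (hx : x ∈ Fintype.piFinset fun _ => net n (m + 1)) :
      (A.sparsifyLaw s).real {T |
        deviation e n r ≤ |∑ i, levelCoeff m x i * (T i - A.mean s i)| ∧
        ∑ i, levelCoeff m x i ^ 2 * (T i - A.mean s i) ^ 2 ≤ v} ≤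
      2 * Real.exp (-(4 ^ m * ((e + 1) * (5 * Real.log n + 2) + 3 * Real.log n))) := by
    rw [Fintype.mem_piFinset] at hx
    refine (measureReal_abs_sum_mul_ge_le A hs hτ (levelCoeff m x) (t := deviation e n r) hv0
      (sum_levelCoeff_sq_mul_le m x (fun j => (mem_net.1 (hx j)).2) _ (fun _ => by positivity) hr.le
        fun J i => by simpa using hnr) (Real.sqrt_nonneg _)).trans_eq ?_
    -- `deviation` is tuned so that `t² / (8 v)` is `4 ^ m` times the entropy term `(e + 1)(5 log n
    -- + 2)` plus `3 log n`; after the union bound the latter leaves `n ^ (-3)`.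
    rw [deviation, Real.sq_sqrt (by positivity), hv]
    congr 3
    have h4 : ((1 : ℝ) / 4) ^ m = (4 ^ m)⁻¹ := by rw [one_div, inv_pow]
    rw [h4]
    field_simp
  have hsub : {T : Tensor (e + 1) n | (∃ x : Fin (e + 1) → Fin n → ℝ,
        (∀ j, x j ∈ net n (m + 1)) ∧
        deviation e n r < |∑ i, levelCoeff m x i * (T i - A.mean s i)|) ∧
      ∀ (J : Fin (e + 1)) (i : Fin e → Fin n),
        ∑ k, (T (J.insertNth k i) - A.mean s (J.insertNth k i)) ^ 2 ≤ r} ⊆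
      ⋃ x ∈ Fintype.piFinset fun _ : Fin (e + 1) => net n (m + 1), {T |
        deviation e n r ≤ |∑ i, levelCoeff m x i * (T i - A.mean s i)| ∧
        ∑ i, levelCoeff m x i ^ 2 * (T i - A.mean s i) ^ 2 ≤ v} := by
    rintro T ⟨⟨x, hx, hT⟩, hfib⟩
    exact Set.mem_biUnion (Finset.mem_coe.2 (Fintype.mem_piFinset.2 hx)) ⟨hT.le,
      sum_levelCoeff_sq_mul_le m x (fun j => (mem_net.1 (hx j)).2)
        (fun i => (T i - A.mean s i) ^ 2) (fun _ => sq_nonneg _) hr.le hfib⟩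
  refine (measureReal_mono hsub (measure_ne_top _ _)).trans ((measureReal_biUnion_finset_le _ _).trans
    ((Finset.sum_le_card_nsmul _ _ _ hx).trans ?_))
  rw [Fintype.card_piFinset_const, nsmul_eq_mul]
  push_cast
  refine (mul_le_mul_of_nonneg_right (pow_le_pow_left₀ (Nat.cast_nonneg _) (card_net_le hn m)
    (e + 1)) (by positivity)).trans ?_
  rw [← Real.exp_nat_mul, mul_left_comm, ← Real.exp_add, div_eq_mul_inv,
    ← Real.exp_log (by positivity : (0 : ℝ) < ((n : ℝ) ^ 3)⁻¹), Real.log_inv, Real.log_pow]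
  refine mul_le_mul_of_nonneg_left (Real.exp_le_exp.2 ?_) zero_le_two
  have h4 : (1 : ℝ) ≤ 4 ^ m := one_le_pow₀ (by norm_num)
  push_cast
  nlinarith

/-- With high probability, the centred sparsified tensor has a small spectral norm. -/
theorem measureReal_form_gt_le {e : ℕ} (A : Tensor (e + 1) n) (hn : 0 < n) {s : ℝ} (hs : 0 < s)
    (hτ : 0 < threshold (e + 1) n) {r : ℝ} (hr : 0 < r) (hnr : n * (A.frobNorm ^ 2 / s) ≤ r)
    (hr' : 2 * n * threshold (e + 1) n + (e + 3) * Real.log n ≤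
      threshold (e + 1) n * s / A.frobNorm ^ 2 * r)
    (M : ℕ) (hM : (n : ℝ) * (1 / 4) ^ M ≤ 1) :
    (A.sparsifyLaw s).real {T | ∃ x : Fin (e + 1) → Fin n → ℝ, (∀ j, ∑ k, x j k ^ 2 ≤ 1) ∧
      (M + 1) * deviation e n r < |form (T - A.mean s) x|} ≤
      (e + 1) / (n : ℝ) ^ 3 + (M + 1) * (2 / (n : ℝ) ^ 3) := by
  have hsub : {T : Tensor (e + 1) n | ∃ x : Fin (e + 1) → Fin n → ℝ, (∀ j, ∑ k, x j k ^ 2 ≤ 1) ∧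
      (M + 1) * deviation e n r < |form (T - A.mean s) x|} ⊆
      {T | ∃ (J : Fin (e + 1)) (i : Fin e → Fin n),
        r < ∑ k, (T (J.insertNth k i) - A.mean s (J.insertNth k i)) ^ 2} ∪
      ⋃ m ∈ Finset.range (M + 1), {T | (∃ x : Fin (e + 1) → Fin n → ℝ,
          (∀ j, x j ∈ net n (m + 1)) ∧
          deviation e n r < |∑ i, levelCoeff m x i * (T i - A.mean s i)|) ∧
        ∀ (J : Fin (e + 1)) (i : Fin e → Fin n),
          ∑ k, (T (J.insertNth k i) - A.mean s (J.insertNth k i)) ^ 2 ≤ r} := by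
    rintro T ⟨x, hx, hT⟩
    by_contra hcon
    simp only [Set.mem_union, Set.mem_ofPred_eq, Set.mem_iUnion, Finset.mem_range, not_or,
      not_exists, not_and, not_lt] at hcon
    obtain ⟨hfib, hlev⟩ := hcon
    obtain ⟨y, hy, hxy⟩ := exists_abs_le_of_mem_convexHull (form (T - A.mean s))
      (net n (M + 1) : Set (Fin n → ℝ)) x fun j => mem_convexHull_net hM (hx j)
    have h := abs_form_le_of_levelCoeff (Nat.succ_pos e) (T - A.mean s) (t := deviation e n r)
      (M + 1) (fun m hm z hz => by
        by_contra hc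
        push Not at hc
        exact hlev m hm ⟨z, hz, hc⟩ hfib) y hy
    push_cast at h
    exact absurd (hxy.trans h) (not_le.2 hT)
  refine (measureReal_mono hsub (measure_ne_top _ _)).trans ((measureReal_union_le _ _).trans
    (add_le_add (measureReal_fiber_le A hn hs hτ hr') ?_))
  refine (measureReal_biUnion_finset_le _ _).trans ((Finset.sum_le_card_nsmul _ _ _ fun m _ =>
    measureReal_level_le A hn hs hτ hr hnr m).trans_eq ?_)
  simp

/-! ### The spectral norm of the error -/

theorem contract_eq_form (A : Tensor d n) (x : Fin d → EuclideanSpace ℝ (Fin n)) :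
    A.contract x = A.form fun j k => x j k := by
  rw [form_apply, contract]

/-- Cauchy–Schwarz: the squared products sum to `∏ j, ∑ k, x j k ^ 2 ≤ 1`. -/
theorem abs_form_le_sqrt_sum_sq (B : Tensor d n) {x : Fin d → Fin n → ℝ}
    (hx : ∀ j, ∑ k, x j k ^ 2 ≤ 1) : |B.form x| ≤ Real.sqrt (∑ i, B i ^ 2) := by
  apply Real.abs_le_sqrt
  rw [form_apply]
  refine (Finset.sum_mul_sq_le_sq_mul_sq _ _ _).trans
    (mul_le_of_le_one_right (Finset.sum_nonneg fun _ _ => sq_nonneg _) ?_)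
  simp_rw [← Finset.prod_pow]
  rw [← Fintype.prod_sum fun (j : Fin d) k => x j k ^ 2]
  exact Finset.prod_le_one (fun _ _ => Finset.sum_nonneg fun _ _ => sq_nonneg _) fun j _ => hx j

theorem sum_sq_eq_one_of_norm_eq_one {x : EuclideanSpace ℝ (Fin n)} (hx : ‖x‖ = 1) :
    ∑ k, x k ^ 2 = 1 := by
  rw [← EuclideanSpace.real_norm_sq_eq, hx, one_pow]

theorem spectralNorm_le {A : Tensor d n} {b : ℝ} (hb : 0 ≤ b)
    (h : ∀ x : Fin d → Fin n → ℝ, (∀ j, ∑ k, x j k ^ 2 ≤ 1) → |A.form x| ≤ b) :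
    A.spectralNorm ≤ b := by
  refine Real.sSup_le ?_ hb
  rintro r ⟨x, hx, rfl⟩
  rw [contract_eq_form]
  exact h _ fun j => (sum_sq_eq_one_of_norm_eq_one (hx j)).le

/-- A set of outputs has large probability if its complement has small probability. -/
theorem one_sub_le_measureReal {α : Type*} [MeasurableSpace α] (μ : Measure α)
    [IsProbabilityMeasure μ] {S B : Set α} {δ : ℝ} (hB : μ.real B ≤ δ) (h : Bᶜ ⊆ S) :
    1 - δ ≤ μ.real S := by
  -- Only monotonicity and subadditivity are used, so neither set need be measurable.
  have h1 : (1 : ℝ) ≤ μ.real (B ∪ S) := by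
    rw [← probReal_univ (μ := μ)]
    refine measureReal_mono fun x _ => ?_
    by_cases hx : x ∈ B
    · exact Or.inl hx
    · exact Or.inr (h hx)
  linarith [measureReal_union_le (μ := μ) B S]

theorem frobNorm_nonneg (A : Tensor d n) : 0 ≤ A.frobNorm := Real.sqrt_nonneg _

theorem abs_form_sub_mean_le (A : Tensor d n) {s : ℝ} (hs : 0 < s) (hn : 0 < n)
    {x : Fin d → Fin n → ℝ} (hx : ∀ j, ∑ k, x j k ^ 2 ≤ 1) :
    |form (A - A.mean s) x| ≤
      Real.sqrt ((n : ℝ) ^ ((d : ℝ) / 2) * Real.log n ^ 2 / s) * A.frobNorm := by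
  have hn' : (0 : ℝ) < n := by exact_mod_cast hn
  refine (abs_form_le_sqrt_sum_sq _ hx).trans ?_
  rw [← Real.sqrt_sq (frobNorm_nonneg A), ← Real.sqrt_mul (by positivity)]
  apply Real.sqrt_le_sqrt
  have hτ : 0 ≤ threshold d n := by unfold threshold; positivity
  refine (Finset.sum_le_card_nsmul _ _ (threshold d n * (A.frobNorm ^ 2 / s)) fun i _ =>
    sq_sub_entryMean_le (sq_nonneg _) hs hτ (A i)).trans_eq ?_
  have hN : ((n : ℝ) ^ d) = (n : ℝ) ^ ((d : ℝ) / 2) * (n : ℝ) ^ ((d : ℝ) / 2) := by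
    rw [← Real.rpow_add hn', add_halves, Real.rpow_natCast]
  simp only [Finset.card_univ, Fintype.card_pi, Finset.prod_const, Fintype.card_fin, nsmul_eq_mul]
  push_cast
  rw [hN, threshold]
  have : 0 < (n : ℝ) ^ ((d : ℝ) / 2) := by positivity
  field_simp

theorem two_le_log {n : ℕ} (hn : 300 ≤ n) : 2 ≤ Real.log n := by
  have hn' : (300 : ℝ) ≤ n := by exact_mod_cast hn
  rw [Real.le_log_iff_exp_le (by linarith), show (2 : ℝ) = 1 + 1 by norm_num, Real.exp_add]
  nlinarith [Real.exp_one_lt_d9, Real.exp_one_gt_d9]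

/-- The constant is `8 · 4 · 9 = 288 ≤ 17²`; the comparison of `5 ^ e` with `64 ^ (e + 1)` is
generous. -/
theorem deviation_le {e : ℕ} {r N L f s : ℝ} (hL : 2 ≤ L) (hN : 0 < N) (hf : 0 ≤ f)
    (hs : 0 < s) (hr : r = 4 * N * (f ^ 2 / s)) :
    Real.sqrt (8 * (e + 1) * 5 ^ e * r * ((e + 1) * (5 * L + 2) + 3 * L)) ≤
      17 * (e + 1) * 8 ^ (e + 1) * Real.sqrt (N * L / s) * f := by
  have h5 : (5 : ℝ) ^ e ≤ (8 ^ (e + 1)) ^ 2 := by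
    rw [← pow_mul, mul_comm, pow_mul]
    calc (5 : ℝ) ^ e ≤ (8 ^ 2) ^ e := pow_le_pow_left₀ (by norm_num) (by norm_num) e
      _ ≤ (8 ^ 2) ^ (e + 1) := pow_le_pow_right₀ (by norm_num) (Nat.le_succ e)
  rw [Real.sqrt_le_left (by positivity)]
  have h1 : (e + 1) * (5 * L + 2) + 3 * L ≤ 9 * (e + 1) * L := by
    have : (0 : ℝ) ≤ e := Nat.cast_nonneg e
    nlinarith [mul_nonneg this (by linarith : 0 ≤ L)]
  rw [mul_pow, mul_pow, mul_pow, mul_pow, Real.sq_sqrt (by positivity), hr]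
  calc 8 * (e + 1) * 5 ^ e * (4 * N * (f ^ 2 / s)) * ((e + 1) * (5 * L + 2) + 3 * L)
      ≤ 8 * (e + 1) * (8 ^ (e + 1)) ^ 2 * (4 * N * (f ^ 2 / s)) * (9 * (e + 1) * L) := by
        gcongr
    _ = 288 * ((e + 1) ^ 2 * (8 ^ (e + 1)) ^ 2 * (N * L / s) * f ^ 2) := by ring
    _ ≤ 289 * ((e + 1) ^ 2 * (8 ^ (e + 1)) ^ 2 * (N * L / s) * f ^ 2) := by
        gcongr; norm_num
    _ = _ := by ring

/-- Here `35 = 1 + 2 · 17`: the bias counts once, and at most `2 L` levels each contribute the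
deviation. -/
theorem error_bound_le {e : ℕ} {r N L f s M' : ℝ} (hL : 2 ≤ L) (hN : 0 < N) (hf : 0 ≤ f)
    (hs : 0 < s) (hr : r = 4 * N * (f ^ 2 / s)) (hML : M' ≤ 2 * L) :
    Real.sqrt (N * L ^ 2 / s) * f +
      M' * Real.sqrt (8 * (e + 1) * 5 ^ e * r * ((e + 1) * (5 * L + 2) + 3 * L)) ≤
      35 * ((e + 1 : ℕ) : ℝ) ^ ((3 : ℝ) / 2) * 8 ^ (e + 1) * Real.sqrt (N * L ^ 3 / s) * f := by
  have h4 := deviation_le (e := e) hL hN hf hs hr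
  set δ := Real.sqrt (8 * (e + 1) * 5 ^ e * r * ((e + 1) * (5 * L + 2) + 3 * L))
  have h5 : L * Real.sqrt (N * L / s) = Real.sqrt (N * L ^ 3 / s) := by
    rw [← Real.sqrt_sq (by linarith : 0 ≤ L), ← Real.sqrt_mul (by positivity),
      Real.sqrt_sq (by linarith)]
    congr 1; ring
  have h6 : Real.sqrt (N * L ^ 2 / s) ≤ Real.sqrt (N * L ^ 3 / s) := by
    apply Real.sqrt_le_sqrt
    gcongr
    · linarith
    · norm_num
  have h7 : ((e : ℝ) + 1) ≤ ((e + 1 : ℕ) : ℝ) ^ ((3 : ℝ) / 2) := by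
    push_cast
    exact Real.self_le_rpow_of_one_le (by linarith [(Nat.cast_nonneg e : (0 : ℝ) ≤ e)]) (by norm_num)
  set R := Real.sqrt (N * L ^ 3 / s) * f with hR
  have hR0 : 0 ≤ R := by positivity
  have h8 : M' * δ ≤ 34 * ((e + 1) * 8 ^ (e + 1)) * R := by
    calc M' * δ
        ≤ 2 * L * (17 * (e + 1) * 8 ^ (e + 1) * Real.sqrt (N * L / s) * f) :=
          mul_le_mul hML h4 (Real.sqrt_nonneg _) (by positivity)
      _ = _ := by rw [hR, ← h5]; ring
  have h9 : Real.sqrt (N * L ^ 2 / s) * f ≤ R := mul_le_mul_of_nonneg_right h6 hf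
  have h10 : (1 : ℝ) ≤ (e + 1) * 8 ^ (e + 1) := by
    have : (1 : ℝ) ≤ 8 ^ (e + 1) := one_le_pow₀ (by norm_num)
    have he0 : (0 : ℝ) ≤ e := Nat.cast_nonneg e
    nlinarith
  have h11 : ((e : ℝ) + 1) * 8 ^ (e + 1) ≤ ((e + 1 : ℕ) : ℝ) ^ ((3 : ℝ) / 2) * 8 ^ (e + 1) :=
    mul_le_mul_of_nonneg_right h7 (by positivity)
  calc _ ≤ R + 34 * ((e + 1) * 8 ^ (e + 1)) * R := by linarith
    _ ≤ 35 * ((e + 1) * 8 ^ (e + 1)) * R := by nlinarith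
    _ ≤ 35 * (((e + 1 : ℕ) : ℝ) ^ ((3 : ℝ) / 2) * 8 ^ (e + 1)) * R := by gcongr
    _ = _ := by rw [hR]; ring

/-- For `F = 0` the keeping rule `F / s ≤ a²` always applies. This case is separate because the
fiber radius would vanish. -/
theorem ae_sparsifyLaw_eq_zero (A : Tensor d n) (s : ℝ) (hf : A.frobNorm = 0) :
    ∀ᵐ T ∂A.sparsifyLaw s, A = 0 ∧ T = 0 := by
  have hA : ∀ i, A i = 0 := by
    have : ∑ i, A i ^ 2 = 0 :=
      (Real.sqrt_eq_zero (Finset.sum_nonneg fun _ _ => sq_nonneg _)).1 hf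
    rw [Finset.sum_eq_zero_iff_of_nonneg fun _ _ => sq_nonneg _] at this
    exact fun i => by simpa using this i (Finset.mem_univ i)
  have := fun i => isProbabilityMeasure_entryLaw (sq_nonneg A.frobNorm) s
    (Real.log n ^ 2 / (n : ℝ) ^ ((d : ℝ) / 2)) (A i)
  have h (i) : ∀ᵐ T ∂A.sparsifyLaw s, T i = 0 := by
    have h0 : ∀ᵐ y ∂entryLaw (A.frobNorm ^ 2) s
        (Real.log n ^ 2 / (n : ℝ) ^ ((d : ℝ) / 2)) (A i), y = 0 := by
      simp [entryLaw, hf, hA i, ae_dirac_eq]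
    exact (Measure.tendsto_eval_ae_ae (μ := fun i => entryLaw (A.frobNorm ^ 2) s
      (Real.log n ^ 2 / (n : ℝ) ^ ((d : ℝ) / 2)) (A i)) (i := i)).eventually h0
  filter_upwards [ae_all_iff.2 h] with T hT
  exact ⟨funext hA, funext hT⟩

/-- The error bound of the sparsification algorithm. -/
theorem spectralNorm_sub_sparsify_le (hn : 300 ≤ n) (hd : 2 ≤ d)
    (hdn : (d : ℝ) ≤ 0.5 * Real.log n) (A : Tensor d n) {s : ℝ} (hs : 0 < s) :
    1 - 1 / (n : ℝ) ≤ (A.sparsifyLaw s).real {T | ∀ x : Fin d → Fin n → ℝ,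
      (∀ j, ∑ k, x j k ^ 2 ≤ 1) → |form (A - T) x| ≤ 35 * (d : ℝ) ^ ((3 : ℝ) / 2) * 8 ^ d *
        Real.sqrt ((n : ℝ) ^ ((d : ℝ) / 2) * Real.log n ^ 3 / s) * A.frobNorm} := by
  have hn0 : 0 < n := by omega
  have hn' : (300 : ℝ) ≤ n := by exact_mod_cast hn
  have hL := two_le_log hn
  have hLn : Real.log n ≤ n := (Real.log_le_sub_one_of_pos (by linarith)).trans (by linarith)
  obtain ⟨e, rfl⟩ : ∃ e, d = e + 1 := ⟨d - 1, by omega⟩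
  have he0 : (0 : ℝ) ≤ e := Nat.cast_nonneg e
  have he : (e : ℝ) + 1 ≤ 0.5 * Real.log n := by exact_mod_cast hdn
  set L := Real.log n with hLdef
  -- Here `d ≥ 2` enters: a fiber has length at most `n ^ (d / 2)`.
  have hnN : (n : ℝ) ≤ (n : ℝ) ^ (((e + 1 : ℕ) : ℝ) / 2) := by
    refine Real.self_le_rpow_of_one_le (by linarith) ?_
    rw [le_div_iff₀ two_pos]
    exact_mod_cast (by omega : 1 * 2 ≤ e + 1)
  have hthr : threshold (e + 1) n * (n : ℝ) ^ (((e + 1 : ℕ) : ℝ) / 2) = L ^ 2 := by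
    have : 0 < (n : ℝ) ^ (((e + 1 : ℕ) : ℝ) / 2) := by positivity
    rw [threshold, div_mul_cancel₀ _ this.ne']
  have hτ : 0 < threshold (e + 1) n := by unfold threshold; positivity
  have hmean := fun (x : Fin (e + 1) → Fin n → ℝ) (hx : ∀ j, ∑ k, x j k ^ 2 ≤ 1) =>
    abs_form_sub_mean_le A hs hn0 hx
  rw [← hLdef] at hmean
  set N := (n : ℝ) ^ (((e + 1 : ℕ) : ℝ) / 2) with hNdef
  have hN0 : 0 < N := by linarith
  have hf0 := frobNorm_nonneg A
  rcases hf0.eq_or_lt with hf | hf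
  · refine one_sub_le_measureReal _ (B := {T | ¬ (A = 0 ∧ T = 0)}) (δ := 1 / n) ?_ fun T hT x _ => ?_
    · rw [measureReal_def, ae_iff.1 (ae_sparsifyLaw_eq_zero A s hf.symm), ENNReal.toReal_zero]
      positivity
    · simp only [Set.mem_compl_iff, Set.mem_ofPred_eq, not_not] at hT
      have h0 : form (A - T) x = 0 := by rw [hT.1, hT.2]; simp [form_apply]
      rw [h0, abs_zero, ← hf, mul_zero]
  set r : ℝ := 4 * N * (A.frobNorm ^ 2 / s) with hr
  have hr0 : 0 < r := by positivity
  -- Since `e < 4`, this many scales give `4 ^ M ≥ n`, as the hull argument needs.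
  set M := ⌈L⌉₊ with hMdef
  have hM : (n : ℝ) * (1 / 4) ^ M ≤ 1 := by
    have h1 : (n : ℝ) ≤ 4 ^ M := by
      rw [← Real.exp_log (by linarith : (0 : ℝ) < n), ← hLdef]
      calc Real.exp L ≤ Real.exp M := Real.exp_le_exp.2 (Nat.le_ceil L)
        _ = Real.exp 1 ^ M := by rw [← Real.exp_nat_mul, mul_one]
        _ ≤ 4 ^ M := pow_le_pow_left₀ (Real.exp_pos 1).le
            (by linarith [Real.exp_one_lt_d9]) M
    rw [one_div, inv_pow, ← div_eq_mul_inv]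
    exact div_le_one_of_le₀ h1 (by positivity)
  have hML : (M : ℝ) + 1 ≤ 2 * L := by
    have := Nat.ceil_lt_add_one (by linarith : 0 ≤ L)
    linarith
  have key := measureReal_form_gt_le A hn0 hs hτ hr0 (by
      rw [hr]
      refine mul_le_mul_of_nonneg_right ?_ (by positivity)
      linarith) (by
      -- As `τ N = L²`, the radius `r = 4 N F / s` gives exponent `4 L²`, which covers `2 n τ ≤ 2
      -- L²` and `(e + 3) L ≤ 2 L²`.
      have h1 : threshold (e + 1) n * s / A.frobNorm ^ 2 * r = 4 * L ^ 2 := by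
        rw [hr, ← hthr]; field_simp
      rw [h1]
      have h2 : n * threshold (e + 1) n ≤ L ^ 2 := by
        rw [← hthr, mul_comm]
        exact mul_le_mul_of_nonneg_left hnN hτ.le
      nlinarith) M hM
  have hδ : (e + 1) / (n : ℝ) ^ 3 + (M + 1) * (2 / (n : ℝ) ^ 3) ≤ 1 / n := by
    have h1 : (e + 1) / (n : ℝ) ^ 3 + (M + 1) * (2 / (n : ℝ) ^ 3) =
        (e + 1 + 2 * (M + 1)) / (n : ℝ) ^ 3 := by ring
    rw [h1, div_le_div_iff₀ (by positivity) (by positivity)]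
    have h2 : (e : ℝ) + 1 + 2 * (M + 1) ≤ 5 * n := by linarith
    have h3 : 5 * (n : ℝ) ≤ n ^ 2 := by nlinarith
    nlinarith
  refine one_sub_le_measureReal _ (key.trans hδ) fun T hT x hx => ?_
  simp only [Set.mem_compl_iff, Set.mem_ofPred_eq, not_exists, not_and, not_lt] at hT
  have h1 := hT x hx
  have h2 := hmean x hx
  have h3 : |form (A - T) x| ≤ |form (A - A.mean s) x| + |form (T - A.mean s) x| := by
    refine le_trans (le_of_eq ?_) (abs_sub _ _)
    congr 1
    simp only [form_apply, ← Finset.sum_sub_distrib, Pi.sub_apply]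
    exact Finset.sum_congr rfl fun i _ => by ring
  exact (h3.trans (add_le_add h2 h1)).trans (error_bound_le hL hN0 hf.le hs hr hML)

/-! ### Matrices -/

theorem frobNorm_ofMatrix (M : Matrix (Fin n) (Fin n) ℝ) :
    (ofMatrix M).frobNorm = matrixFrobNorm M := by
  unfold frobNorm matrixFrobNorm ofMatrix
  rw [← (finTwoArrowEquiv (Fin n)).symm.sum_comp, Fintype.sum_prod_type]
  simp

theorem form_ofMatrix_sub (M : Matrix (Fin n) (Fin n) ℝ) (T : Tensor 2 n) (x y : Fin n → ℝ) :
    form (ofMatrix M - T) ![x, y] = x ⬝ᵥ ((M - T.toMatrix).mulVec y) := by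
  rw [form_apply, ← (finTwoArrowEquiv (Fin n)).symm.sum_comp, Fintype.sum_prod_type]
  simp only [dotProduct, Matrix.mulVec, Finset.mul_sum]
  refine Finset.sum_congr rfl fun i _ => Finset.sum_congr rfl fun j _ => ?_
  simp [ofMatrix, toMatrix]
  ring

/-- The operator norm is tested on inner products with pairs of unit vectors, that is, on the
bilinear form. -/
theorem matrixSpectralNorm_le {M : Matrix (Fin n) (Fin n) ℝ} {b : ℝ} (hb : 0 ≤ b)
    (h : ∀ x y : Fin n → ℝ, ∑ k, x k ^ 2 ≤ 1 → ∑ k, y k ^ 2 ≤ 1 → x ⬝ᵥ M.mulVec y ≤ b) :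
    matrixSpectralNorm M ≤ b := by
  refine ContinuousLinearMap.opNorm_le_of_re_inner_le hb fun y x hy hx => ?_
  have := h x.ofLp y.ofLp (sum_sq_eq_one_of_norm_eq_one hx).le
    (sum_sq_eq_one_of_norm_eq_one hy).le
  simpa [EuclideanSpace.inner_eq_star_dotProduct] using this

theorem matrixSpectralNorm_sub_toMatrix_le {M : Matrix (Fin n) (Fin n) ℝ} {T : Tensor 2 n} {b : ℝ}
    (hb : 0 ≤ b) (h : ∀ x : Fin 2 → Fin n → ℝ, (∀ j, ∑ k, x j k ^ 2 ≤ 1) →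
      |form (ofMatrix M - T) x| ≤ b) :
    matrixSpectralNorm (M - T.toMatrix) ≤ b := by
  refine matrixSpectralNorm_le hb fun x y hx hy => ?_
  rw [← form_ofMatrix_sub]
  refine (le_abs_self _).trans (h _ fun j => ?_)
  fin_cases j
  · exact hx
  · exact hy

theorem sq_rpow_three_halves {x : ℝ} (hx : 0 ≤ x) : (x ^ ((3 : ℝ) / 2)) ^ 2 = x ^ 3 := by
  rw [← Real.rpow_natCast, ← Real.rpow_mul hx, ← Real.rpow_natCast]
  norm_num

/-- The number of samples that makes an error `a √(b / s)` at most `ε`. -/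
theorem mul_sqrt_div_le_of_le {a b ε s : ℝ} (ha : 0 ≤ a) (hε : 0 < ε)
    (hs : 0 < s) (h : a ^ 2 * b / ε ^ 2 ≤ s) : a * Real.sqrt (b / s) ≤ ε := by
  rw [← Real.sqrt_sq ha, ← Real.sqrt_mul (sq_nonneg a), Real.sqrt_le_left hε.le, ← mul_div_assoc,
    div_le_iff₀ hs]
  rw [div_le_iff₀ (by positivity)] at h
  linarith

end Tensor

theorem mainTheorem3 :
    (∃ c : ℝ, 0 < c ∧
      ∀ (n d : ℕ), 300 ≤ n → 2 ≤ d → (d : ℝ) ≤ 0.5 * Real.log n →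
      ∀ (A : Tensor d n) (s : ℝ), 0 < s →
        1 - 1 / (n : ℝ) ≤ (A.sparsifyLaw s).real
          {T | (A - T).spectralNorm ≤
            c * (d : ℝ) ^ ((3 : ℝ) / 2) * 8 ^ d *
              Real.sqrt ((n : ℝ) ^ ((d : ℝ) / 2) * Real.log n ^ 3 / s) * A.frobNorm}) ∧
    (∃ C : ℝ, 0 < C ∧
      ∀ (n d : ℕ), 300 ≤ n → 2 ≤ d → (d : ℝ) ≤ 0.5 * Real.log n →
      ∀ (A : Tensor d n) (ε s : ℝ), 0 < ε →
        C * ((d : ℝ) ^ 3 * 64 ^ d * (n : ℝ) ^ ((d : ℝ) / 2) * Real.log n ^ 3 / ε ^ 2) ≤ s →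
        1 - 1 / (n : ℝ) ≤ (A.sparsifyLaw s).real
          {T | (A - T).spectralNorm ≤ ε * A.frobNorm}) ∧
    (∃ c : ℝ, 0 < c ∧
      ∀ n : ℕ, 300 ≤ n →
      ∀ (M : Matrix (Fin n) (Fin n) ℝ) (s : ℝ), 0 < s →
        1 - 1 / (n : ℝ) ≤ ((Tensor.ofMatrix M).sparsifyLaw s).real
          {T | matrixSpectralNorm (M - T.toMatrix) ≤
            c * Real.sqrt (n * Real.log n ^ 3 / s) * matrixFrobNorm M}) ∧
    (∃ C : ℝ, 0 < C ∧
      ∀ n : ℕ, 300 ≤ n →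
      ∀ (M : Matrix (Fin n) (Fin n) ℝ) (ε s : ℝ), 0 < ε →
        C * (n * Real.log n ^ 3 / ε ^ 2) ≤ s →
        1 - 1 / (n : ℝ) ≤ ((Tensor.ofMatrix M).sparsifyLaw s).real
          {T | matrixSpectralNorm (M - T.toMatrix) ≤ ε * matrixFrobNorm M}) := by
  have hlog {n : ℕ} (hn : 300 ≤ n) : 0 < Real.log n := by linarith [Tensor.two_le_log hn]
  have tensor (n d : ℕ) (hn : 300 ≤ n) (hd : 2 ≤ d) (hdn : (d : ℝ) ≤ 0.5 * Real.log n)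
      (A : Tensor d n) (s : ℝ) (hs : 0 < s) :
      1 - 1 / (n : ℝ) ≤ (A.sparsifyLaw s).real {T | (A - T).spectralNorm ≤
        35 * (d : ℝ) ^ ((3 : ℝ) / 2) * 8 ^ d *
          Real.sqrt ((n : ℝ) ^ ((d : ℝ) / 2) * Real.log n ^ 3 / s) * A.frobNorm} :=
    (Tensor.spectralNorm_sub_sparsify_le hn hd hdn A hs).trans <| measureReal_mono fun T hT =>
      Tensor.spectralNorm_le (mul_nonneg (by positivity) A.frobNorm_nonneg) hT
  have matrix (n : ℕ) (hn : 300 ≤ n) (M : Matrix (Fin n) (Fin n) ℝ) (s : ℝ) (hs : 0 < s) :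
      1 - 1 / (n : ℝ) ≤ ((Tensor.ofMatrix M).sparsifyLaw s).real
        {T | matrixSpectralNorm (M - T.toMatrix) ≤ 35 * (2 : ℝ) ^ ((3 : ℝ) / 2) * 8 ^ 2 *
          Real.sqrt (n * Real.log n ^ 3 / s) * matrixFrobNorm M} := by
    have h := Tensor.spectralNorm_sub_sparsify_le hn le_rfl
      (by
        have hn' : (300 : ℝ) ≤ n := by exact_mod_cast hn
        -- The condition `d ≤ 0.5 log n` at `d = 2`, from `exp 4 ≤ 3 ^ 4 = 81 ≤ n`.
        have : 4 ≤ Real.log n := by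
          rw [Real.le_log_iff_exp_le (by linarith), show (4 : ℝ) = ((4 : ℕ) : ℝ) * 1 by norm_num,
            Real.exp_nat_mul]
          calc Real.exp 1 ^ 4 ≤ 3 ^ 4 := pow_le_pow_left₀ (Real.exp_pos 1).le
                (by linarith [Real.exp_one_lt_d9]) 4
            _ ≤ n := by linarith
        push_cast
        linarith) (Tensor.ofMatrix M) hs
    have hn1 : (n : ℝ) ^ (((2 : ℕ) : ℝ) / 2) = n := by norm_num
    rw [hn1, Tensor.frobNorm_ofMatrix] at h
    exact h.trans <| measureReal_mono fun T hT => Tensor.matrixSpectralNorm_sub_toMatrix_le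
      (mul_nonneg (by positivity) (Real.sqrt_nonneg _)) hT
  -- Sample-size constants are squares of the error constants, since `a √(b / s) ≤ ε` amounts to `s
  -- ≥ a² b / ε²`. For matrices `d ^ (3/2) 8 ^ d` is absorbed at `d = 2`.
  refine ⟨⟨35, by norm_num, tensor⟩, ⟨35 ^ 2, by norm_num, fun n d hn hd hdn A ε s hε hs => ?_⟩,
    ⟨35 * (2 : ℝ) ^ ((3 : ℝ) / 2) * 8 ^ 2, by positivity, matrix⟩,
    ⟨(35 * (2 : ℝ) ^ ((3 : ℝ) / 2) * 8 ^ 2) ^ 2, by positivity, fun n hn M ε s hε hs => ?_⟩⟩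
  · have hL := hlog hn
    have hn0 : (0 : ℝ) < n := by exact_mod_cast (by omega : 0 < n)
    have hd0 : (0 : ℝ) < d := by exact_mod_cast (by omega : 0 < d)
    have hs0 : 0 < s := lt_of_lt_of_le (by positivity) hs
    refine (tensor n d hn hd hdn A s hs0).trans <| measureReal_mono fun T hT =>
      le_trans hT (mul_le_mul_of_nonneg_right ?_ A.frobNorm_nonneg)
    refine Tensor.mul_sqrt_div_le_of_le (by positivity) hε hs0 (le_trans ?_ hs)
    have h8 : ((8 : ℝ) ^ d) ^ 2 = 64 ^ d := by rw [← pow_mul, mul_comm, pow_mul]; norm_num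
    rw [mul_pow, mul_pow, Tensor.sq_rpow_three_halves hd0.le, h8]
    exact le_of_eq (by ring)
  · have hL := hlog hn
    have hn0 : (0 : ℝ) < n := by exact_mod_cast (by omega : 0 < n)
    have hs0 : 0 < s := lt_of_lt_of_le (by positivity) hs
    refine (matrix n hn M s hs0).trans <| measureReal_mono fun T hT =>
      le_trans hT (mul_le_mul_of_nonneg_right ?_ (Real.sqrt_nonneg _))
    refine Tensor.mul_sqrt_div_le_of_le (by positivity) hε hs0 (le_trans ?_ hs)
    rw [mul_div_assoc]
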